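/- Let $F\colon\mathbb{R}^d\to\mathbb{R}^d$ be $L$-Lipschitz with $L>0$, let $G\colon\mathbb{R}^d\rightrightarrows\mathbb{R}^d$ be maximally monotone, and let $F+G$ be maximally $\rho$-cohypomonotone with $\rho\ge 0$; that is, $\langle u-v,x-y\rangle\ge-\rho\|u-v\|^2$ for all $(x,u),(y,v)$ in the graph of $F+G$, and this graph is not strictly contained in the graph of another operator with this property. Let $\rho<\eta<\frac1L$, let $x^\star$ satisfy $0\in F(x^\star)+G(x^\star)$, and let $x_0\in\mathbb{R}^d$. For a set-valued operator $A$, let $J_A=(\mathrm{Id}+A)^{-1}$ denote its resolvent. Put $\alpha=1-\frac{\rho}{\eta}$, $\beta_k=\frac1{k+2}$, $\tau=\frac{1}{2(1+\eta L)}$ and $$N_k=\left\lceil\frac{4(1+\eta L)}{1-\eta L}\log\bigl(98\sqrt{k+2}\,\log(k+2)\bigr)\right\rceil .$$ The inexact Halpern iteration computes, for $k=0,1,2,\dots$, $$x_{k+1}=\beta_kx_0+(1-\beta_k)\bigl((1-\alpha)x_k+\alpha\widetilde J_k\bigr),$$ where $\widetilde J_k=z_{N_k}$ is the result of $N_k$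 forward-backward-forward steps started at $z_0=x_k$: with $B(z)=z+\eta F(z)-x_k$, $$z_{t+1/2}=J_{\tau\eta G}\bigl(z_t-\tau B(z_t)\bigr),\qquad z_{t+1}=z_{t+1/2}+\tau B(z_t)-\tau B(z_{t+1/2}),\qquad t=0,\dots,N_k-1 .$$ Then the resolvents $J_{cG}$ ($c>0$) and $J_{\eta(F+G)}$ are single-valued and defined on all of $\mathbb{R}^d$, and for every $k\ge1$, $$\frac1{\eta^2}\,\|x_k-J_{\eta(F+G)}(x_k)\|^2\le\frac{16\,\|x_0-x^\star\|^2}{(\eta-\rho)^2(k+1)^2}.$$ Moreover, for every $k\ge0$, iteration $k$ (the computation of $x_{k+1}$ from $x_k$) uses at most $2N_k$ first-order oracle calls, where one call consists of one evaluation of $F$ and one evaluation of a resolvent $J_{cG}$ (so that a run with $m$ evaluations of $F$ and $n$ of resolvents uses $\max(m,n)$ calls). -/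

import Mathlib

open scoped NNReal

noncomputable section

/-- The space `ℝ^d` with the `ℓ₂` norm. -/
abbrev Vec (d : ℕ) : Type := EuclideanSpace ℝ (Fin d)

/-! ### Set-valued operators on a real inner product space -/

namespace SetOp

variable {E : Type*} [NormedAddCommGroup E] [InnerProductSpace ℝ E]

/-- The graph of a set-valued operator. -/
def graph (A : E → Set E) : Set (E × E) := {p | p.2 ∈ A p.1}

/-- `⟨u - v, x - y⟩ ≥ 0` for all `(x, u)`, `(y, v)` in the graph. -/
def IsMonotone (A : E → Set E) : Prop :=
  ∀ x u y v, (x, u) ∈ graph A → (y, v) ∈ graph A → 0 ≤ inner ℝ (u - v) (x - y)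

/-- `⟨u - v, x - y⟩ ≥ -ρ ‖u - v‖²` for all `(x, u)`, `(y, v)` in the graph. -/
def IsCohypomonotone (ρ : ℝ) (A : E → Set E) : Prop :=
  ∀ x u y v, (x, u) ∈ graph A → (y, v) ∈ graph A →
    -ρ * ‖u - v‖ ^ 2 ≤ inner ℝ (u - v) (x - y)

/-- A monotone operator whose graph is not strictly contained in the graph of a monotone
operator. -/
def IsMaximallyMonotone (A : E → Set E) : Prop :=
  IsMonotone A ∧ ∀ B : E → Set E, IsMonotone B → ¬ graph A ⊂ graph B

/-- A `ρ`-cohypomonotone operator whose graph is not strictly contained in the graph of a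
`ρ`-cohypomonotone operator. -/
def IsMaximallyCohypomonotone (ρ : ℝ) (A : E → Set E) : Prop :=
  IsCohypomonotone ρ A ∧ ∀ B : E → Set E, IsCohypomonotone ρ B → ¬ graph A ⊂ graph B

/-- The sum `F + G` of a single-valued and a set-valued operator. -/
def add (F : E → E) (G : E → Set E) : E → Set E := fun x => {w | ∃ u ∈ G x, w = F x + u}

/-- The operator `c A`. -/
def scale (c : ℝ) (A : E → Set E) : E → Set E := fun x => {w | ∃ u ∈ A x, w = c • u}

/-- The resolvent `J_A = (Id + A)⁻¹`, as a set-valued operator: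
`y ∈ J_A x` iff `x ∈ y + A y`. -/
def resolvent (A : E → Set E) : E → Set E := fun x => {y | ∃ u ∈ A y, x = y + u}

/-- The value of the resolvent at a point where it is single-valued
(an arbitrary element of `J_A x` if there are several, a junk value if there is none). -/
def resolventMap (A : E → Set E) (x : E) : E := Classical.epsilon fun y => y ∈ resolvent A x

end SetOp

/-! ### Programs with oracle access to an operator `F` and to the resolvents of `G` -/

/-- A program that computes a value of type `α` and reaches the operators `F` and `G` only through
two kinds of queries: `evalF x` (answered by `F x`) and `resolventG c y` (answered by
`J_{c G} y`). -/
inductive OracleProg (E : Type*) (α : Type*) where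
  | ret : α → OracleProg E α
  | evalF : E → (E → OracleProg E α) → OracleProg E α
  | resolventG : ℝ → E → (E → OracleProg E α) → OracleProg E α

namespace OracleProg

variable {E : Type*} {α β : Type*}

/-- Sequential composition of programs. -/
def andThen : OracleProg E α → (α → OracleProg E β) → OracleProg E β
  | ret a, f => f a
  | evalF x k, f => evalF x fun v => andThen (k v) f
  | resolventG c y k, f => resolventG c y fun v => andThen (k v) f

instance : Monad (OracleProg E) where
  pure := ret
  bind := andThen

/-- The program that makes one evaluation of `F`. -/
def queryF (x : E) : OracleProg E E := evalF x ret

/-- The program that makes one evaluation of the resolvent `J_{c G}`. -/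
def queryResolvent (c : ℝ) (y : E) : OracleProg E E := resolventG c y ret

variable [NormedAddCommGroup E] [InnerProductSpace ℝ E] (F : E → E) (G : E → Set E)

/-- The value computed by a program. -/
def value : OracleProg E α → α
  | ret a => a
  | evalF x k => value (k (F x))
  | resolventG c y k => value (k (SetOp.resolventMap (SetOp.scale c G) y))

/-- The number of evaluations of `F` made by a run of the program. -/
def countF : OracleProg E α → ℕ
  | ret _ => 0
  | evalF x k => countF (k (F x)) + 1
  | resolventG c y k => countF (k (SetOp.resolventMap (SetOp.scale c G) y))

/-- The number of resolvent evaluations made by a run of the program. -/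
def countResolvent : OracleProg E α → ℕ
  | ret _ => 0
  | evalF x k => countResolvent (k (F x))
  | resolventG c y k => countResolvent (k (SetOp.resolventMap (SetOp.scale c G) y)) + 1

/-- The number of first-order oracle calls used by a run of the program. One call pays for one
evaluation of `F` and one resolvent of `G`, so that `m` calls pay for at most `m` evaluations of
`F` and at most `m` resolvents of `G`. -/
def oracleCalls (p : OracleProg E α) : ℕ := max (countF F G p) (countResolvent F G p)

end OracleProg

/-! ### The algorithms -/

namespace Halpern

open OracleProg

variable {E : Type*} [NormedAddCommGroup E] [InnerProductSpace ℝ E]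

/-- One forward-backward-forward step from `z`, with step size `τ`, for the operators `A` and
`B = B_in - z₀`; `JA τ` is a program for the resolvent of `τ A`, and `Bin` one for `B_in`. -/
def fbfStep (z₀ : E) (JA : ℝ → E → OracleProg E E) (Bin : E → OracleProg E E) (τ : ℝ) (z : E) :
    OracleProg E E := do
  let b ← Bin z
  let zHalf ← JA τ (z - τ • (b - z₀))
  let bHalf ← Bin zHalf
  return zHalf + τ • (b - z₀) - τ • (bHalf - z₀)

/-- `FBF(z₀, N, A, B_in, L_B)`: `N` forward-backward-forward steps with `τ = 1 / (2 L_B)`,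
started at `z₀`. -/
def fbf (z₀ : E) (N : ℕ) (JA : ℝ → E → OracleProg E E) (Bin : E → OracleProg E E) (LB : ℝ) :
    OracleProg E E :=
  match N with
  | 0 => return z₀
  | t + 1 => do
    let z ← fbf z₀ t JA Bin LB
    fbfStep z₀ JA Bin (1 / (2 * LB)) z

/-- `N_k = ⌈4 (1 + ηL) / (1 - ηL) · log (98 √(k+2) log (k+2))⌉`. -/
def innerIterations (η L : ℝ) (k : ℕ) : ℕ :=
  ⌈4 * (1 + η * L) / (1 - η * L) *
    Real.log (98 * Real.sqrt ((k : ℝ) + 2) * Real.log ((k : ℝ) + 2))⌉₊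

/-- The approximation `FBF(x, N, ηG, Id + ηF, 1 + ηL)` of `J_{η(F+G)} x`. The resolvent of
`τ (η G)` is the resolvent of `(τ η) G`. -/
def approxResolvent (η L : ℝ) (N : ℕ) (x : E) : OracleProg E E :=
  fbf x N (fun τ y => queryResolvent (τ * η) y)
    (fun z => do
      let v ← queryF z
      return z + η • v)
    (1 + η * L)

/-- Iteration `k` of the inexact Halpern iteration, from the current iterate `x`, with
`β_k = 1 / (k + 2)` and `α = 1 - ρ / η`. -/
def step (η L ρ : ℝ) (x₀ : E) (k : ℕ) (x : E) : OracleProg E E := do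
  let J ← approxResolvent η L (innerIterations η L k) x
  let β : ℝ := 1 / ((k : ℝ) + 2)
  let α : ℝ := 1 - ρ / η
  return β • x₀ + (1 - β) • ((1 - α) • x + α • J)

/-- The iterates `x_k` of the inexact Halpern iteration. -/
def iterate (F : E → E) (G : E → Set E) (η L ρ : ℝ) (x₀ : E) : ℕ → E
  | 0 => x₀
  | k + 1 => value F G (step η L ρ x₀ k (iterate F G η L ρ x₀ k))

/-- The number of first-order oracle calls used in iteration `k`, which computes `x_{k+1}` from
`x_k`. -/
def callsAt (F : E → E) (G : E → Set E) (η L ρ : ℝ) (x₀ : E) (k : ℕ) : ℕ :=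
  oracleCalls F G (step η L ρ x₀ k (iterate F G η L ρ x₀ k))

end Halpern

end

/-!
Write `J = J_{η(F+G)}`. Since `F + G` is `ρ`-cohypomonotone, `R x = (1 - ρ/η) (x - J x)` is firmly
nonexpansive, and it vanishes at `x⋆`. Under the exact Halpern iteration the potential
`k (k+1)/2 ‖R x_k‖² + (k+1) ⟪R x_k, x_k - x₀⟫` does not increase, and as long as it is at most
`4 ‖x₀ - x⋆‖²` one has `(k+1) ‖R x_k‖ ≤ 4 ‖x₀ - x⋆‖`. One forward-backward-forward step multiplies
the squared distance to `J x_k` by at most `exp (-(1 - ηL) / (2 (1 + ηL)))`, so `N_k` of them give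
`J x_k` with relative error `ε_k = 1 / (98 √(k+2) log (k+2))`. This error raises the potential by at
most `((k+1) ‖R x_k‖)² (ε_k² + ε_k/(k+1))`, and since these `ε`-factors sum to at most `1/4` the
potential stays below `4 ‖x₀ - x⋆‖²` by induction. Resolvents are defined everywhere by Minty's
argument: the compatibility conditions on a point of `J x` are membership in closed balls, any
finitely many of which meet by a minimax argument, hence all by weak compactness.
-/

section Antimonotone

variable {E : Type*} [NormedAddCommGroup E] [InnerProductSpace ℝ E] {ι : Type*}

theorem inner_sub_sub_eq_norm_sub_midpoint_sq_sub (a c z : E) :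
    inner ℝ (z - a) (z - c) = ‖z - midpoint ℝ a c‖ ^ 2 - (‖a - c‖ / 2) ^ 2 := by
  have ha : z - a = (z - midpoint ℝ a c) - (1 / 2 : ℝ) • (a - c) := by
    rw [midpoint_eq_smul_add, invOf_eq_inv]; module
  have hc : z - c = (z - midpoint ℝ a c) + (1 / 2 : ℝ) • (a - c) := by
    rw [midpoint_eq_smul_add, invOf_eq_inv]; module
  rw [ha, hc, inner_sub_left, inner_add_right, inner_add_right, real_inner_comm _ (_ • (a - c)),
    real_inner_self_eq_norm_sq, real_inner_self_eq_norm_sq, norm_smul]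
  norm_num
  ring

theorem inner_sub_sub_nonpos_iff_mem_closedBall {a c z : E} :
    inner ℝ (z - a) (z - c) ≤ 0 ↔ z ∈ Metric.closedBall (midpoint ℝ a c) (‖a - c‖ / 2) := by
  rw [inner_sub_sub_eq_norm_sub_midpoint_sq_sub, sub_nonpos, mem_closedBall_iff_norm]
  exact sq_le_sq₀ (norm_nonneg _) (by positivity)

theorem convexOn_sum_mul {s : Set E} (hs : Convex ℝ s) [Fintype ι] {w : ι → ℝ}
    (hw : ∀ i, 0 ≤ w i) {f : ι → E → ℝ} (hf : ∀ i, ConvexOn ℝ s (f i)) :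
    ConvexOn ℝ s fun z => ∑ i, w i * f i z := by
  have := Finset.sum_induction (fun i => w i • f i) (ConvexOn ℝ s) (s := Finset.univ)
    (fun _ _ => ConvexOn.add) (convexOn_const 0 hs) fun i _ => (hf i).smul (hw i)
  simpa only [Finset.sum_fn, Pi.smul_apply, smul_eq_mul] using this

theorem convexOn_inner_sub_sub (a c : E) :
    ConvexOn ℝ Set.univ fun z : E => inner ℝ (z - a) (z - c) := by
  simp only [inner_sub_sub_eq_norm_sub_midpoint_sq_sub, ← dist_eq_norm]
  exact ((convexOn_univ_dist _).pow (fun _ _ => dist_nonneg) 2).sub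
    (concaveOn_const _ convex_univ)

theorem two_mul_sum_mul_inner_sum_smul_sub [Fintype ι] {w : ι → ℝ} (hw : ∑ i, w i = 1)
    (a c : ι → E) (y : E) :
    2 * ∑ i, w i * inner ℝ (∑ j, w j • a j - a i) (y - c i) =
      ∑ i, ∑ j, w i * w j * inner ℝ (a i - a j) (c i - c j) := by
  let s : ι → ι → ℝ := fun i j => w i * w j * inner ℝ (a i - a j) (c i - y)
  have hs : ∀ i, ∑ j, s i j = w i * inner ℝ (∑ j, w j • a j - a i) (y - c i) := fun i => by
    have hcentre : a i - ∑ j, w j • a j = ∑ j, w j • (a i - a j) := by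
      simp only [smul_sub, Finset.sum_sub_distrib, ← Finset.sum_smul, hw, one_smul]
    rw [← inner_neg_neg, neg_sub, neg_sub, hcentre, sum_inner, Finset.mul_sum]
    simp only [s, real_inner_smul_left, mul_assoc]
  calc 2 * ∑ i, w i * inner ℝ (∑ j, w j • a j - a i) (y - c i)
      = ∑ i, ∑ j, s i j + ∑ i, ∑ j, s j i := by
        rw [Finset.sum_comm (f := fun i j => s j i), ← two_mul]; simp only [hs]
    _ = _ := by
        simp only [← Finset.sum_add_distrib]
        refine Finset.sum_congr rfl fun i _ => Finset.sum_congr rfl fun j _ => ?_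
        simp only [s, inner_sub_left, inner_sub_right]
        ring

/-- At a saddle point `(z, w)` of `∑ i, w i * ⟪z - a i, z - c i⟫`, comparison with the
barycentre of the `a i` shows that the value is nonpositive. -/
theorem exists_forall_inner_sub_sub_nonpos_of_finite [Finite ι] (a c : ι → E)
    (h : ∀ i j, inner ℝ (a i - a j) (c i - c j) ≤ 0) :
    ∃ z, ∀ i, inner ℝ (z - a i) (z - c i) ≤ 0 := by
  classical
  cases nonempty_fintype ι
  rcases isEmpty_or_nonempty ι with _ | _
  · exact ⟨0, isEmptyElim⟩
  let f : E → (ι → ℝ) → ℝ := fun z w => ∑ i, w i * inner ℝ (z - a i) (z - c i)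
  let X : Set E := convexHull ℝ (Set.range a)
  obtain ⟨z, -, w, hw, hsaddle⟩ : ∃ z ∈ X, ∃ w ∈ stdSimplex ℝ ι,
      IsSaddlePointOn X (stdSimplex ℝ ι) f z w := by
    refine Sion.exists_isSaddlePointOn (Set.range_nonempty a).convexHull (convex_convexHull ℝ _)
      ((Set.finite_range a).isCompact_convexHull ℝ) (fun w _ => ?_) (fun w hw => ?_)
      (convex_stdSimplex ℝ ι) ⟨_, single_mem_stdSimplex ℝ (Classical.arbitrary ι)⟩
      (isCompact_stdSimplex ℝ ι) (fun z _ => ?_) (fun z _ => ?_)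
    · exact (by fun_prop : Continuous fun z => f z w).lowerSemicontinuous.lowerSemicontinuousOn _
    · exact ((convexOn_sum_mul convex_univ hw.1 fun i => convexOn_inner_sub_sub _ _).subset
        (Set.subset_univ _) (convex_convexHull ℝ _)).quasiconvexOn
    · exact (by fun_prop : Continuous (f z)).upperSemicontinuous.upperSemicontinuousOn _
    · exact ((Fintype.linearCombination ℝ _).concaveOn (convex_stdSimplex ℝ ι)).quasiconcaveOn
  have hcenter : ∑ i, w i • a i ∈ X :=
    (convex_convexHull ℝ _).sum_mem (fun i _ => hw.1 i) hw.2 fun i _ =>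
      subset_convexHull ℝ _ (Set.mem_range_self i)
  refine ⟨z, fun i => ?_⟩
  calc inner ℝ (z - a i) (z - c i) = f z (Pi.single i 1) := by simp [f, Pi.single_apply]
    _ ≤ f (∑ i, w i • a i) w := hsaddle _ hcenter _ (single_mem_stdSimplex ℝ i)
    _ ≤ 0 := by
      have := two_mul_sum_mul_inner_sum_smul_sub hw.2 a c (∑ i, w i • a i)
      have hle : ∑ i, ∑ j, w i * w j * inner ℝ (a i - a j) (c i - c j) ≤ 0 :=
        Finset.sum_nonpos fun i _ => Finset.sum_nonpos fun j _ =>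
          mul_nonpos_of_nonneg_of_nonpos (mul_nonneg (hw.1 i) (hw.1 j)) (h i j)
      linarith

theorem exists_forall_mem_closedBall_of_finset [CompleteSpace E] {ι : Type*} (m : ι → E)
    (r : ι → ℝ) (h : ∀ u : Finset ι, ∃ z, ∀ i ∈ u, z ∈ Metric.closedBall (m i) (r i)) :
    ∃ z, ∀ i, z ∈ Metric.closedBall (m i) (r i) := by
  classical
  rcases isEmpty_or_nonempty ι with _ | ⟨⟨i₀⟩⟩
  · exact ⟨0, isEmptyElim⟩
  let e := InnerProductSpace.toDual ℝ E
  let K : ι → Set (WeakDual ℝ E) := fun i =>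
    WeakDual.toStrongDual ⁻¹' Metric.closedBall (e (m i)) (r i)
  have he : ∀ z i, StrongDual.toWeakDual (e z) ∈ K i ↔ z ∈ Metric.closedBall (m i) (r i) :=
    fun z i => by simp [K, dist_eq_norm, ← map_sub]
  obtain ⟨φ, -, hφ⟩ := (WeakDual.isCompact_closedBall (e (m i₀)) (r i₀)).inter_iInter_nonempty K
    (fun i => WeakDual.isClosed_closedBall _ _) fun u => by
      obtain ⟨z, hz⟩ := h (insert i₀ u)
      refine ⟨StrongDual.toWeakDual (e z), (he z i₀).2 (hz i₀ (u.mem_insert_self i₀)),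
        Set.mem_iInter₂.2 fun i hi => (he z i).2 (hz i (Finset.mem_insert_of_mem hi))⟩
  refine ⟨e.symm φ.toStrongDual, fun i => (he _ i).1 ?_⟩
  simpa using Set.mem_iInter.1 hφ i

theorem exists_forall_inner_sub_sub_nonpos [CompleteSpace E] (a c : ι → E)
    (h : ∀ i j, inner ℝ (a i - a j) (c i - c j) ≤ 0) :
    ∃ z, ∀ i, inner ℝ (z - a i) (z - c i) ≤ 0 := by
  simp only [inner_sub_sub_nonpos_iff_mem_closedBall]
  refine exists_forall_mem_closedBall_of_finset _ _ fun u => ?_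
  obtain ⟨z, hz⟩ := exists_forall_inner_sub_sub_nonpos_of_finite (fun i : u => a i)
    (fun i => c i) fun i j => h i j
  exact ⟨z, fun i hi => inner_sub_sub_nonpos_iff_mem_closedBall.1 (hz ⟨i, hi⟩)⟩

end Antimonotone

namespace SetOp

variable {E : Type*} [NormedAddCommGroup E] [InnerProductSpace ℝ E]
  {A : E → Set E} {a b c ρ η : ℝ} {x y z u v w : E}

theorem scale_scale : scale a (scale b A) = scale (a * b) A := by
  ext
  simp [scale, mul_smul]

theorem IsMonotone.scale (hA : IsMonotone A) (hc : 0 ≤ c) : IsMonotone (scale c A) := by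
  rintro x _ y _ ⟨u, hu, rfl⟩ ⟨v, hv, rfl⟩
  rw [← smul_sub, real_inner_smul_left]
  exact mul_nonneg hc (hA x u y v hu hv)

theorem mem_resolvent_scale_add_iff {F : E → E} {G : E → Set E} :
    z ∈ resolvent (scale c (add F G)) x ↔ -(z + c • F z - x) ∈ scale c G z := by
  constructor
  · rintro ⟨_, ⟨_, ⟨u, hu, rfl⟩, rfl⟩, rfl⟩
    exact ⟨u, hu, by module⟩
  · rintro ⟨u, hu, h⟩
    refine ⟨_, ⟨_, ⟨u, hu, rfl⟩, rfl⟩, ?_⟩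
    rw [smul_add, ← h]
    abel

theorem resolventMap_mem {E : Type*} [NormedAddCommGroup E] {A : E → Set E} {x : E}
    (h : ∃ y, y ∈ resolvent A x) : resolventMap A x ∈ resolvent A x :=
  Classical.epsilon_spec h

theorem inner_sub_add_smul_sub_add_smul :
    inner ℝ (u - v) (x + η • u - (y + η • v)) = inner ℝ (u - v) (x - y) + η * ‖u - v‖ ^ 2 := by
  rw [← real_inner_self_eq_norm_sq, ← real_inner_smul_right, ← inner_add_right]
  congr 1
  module

theorem IsCohypomonotone.mul_norm_sub_sq_le (hA : IsCohypomonotone ρ A) (hu : u ∈ A x)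
    (hv : v ∈ A y) :
    (η - ρ) * ‖u - v‖ ^ 2 ≤ inner ℝ (u - v) (x + η • u - (y + η • v)) := by
  rw [inner_sub_add_smul_sub_add_smul]
  linarith [hA x u y v hu hv]

theorem IsCohypomonotone.eq_of_mem_resolvent (hA : IsCohypomonotone ρ A) (hρ : ρ < c)
    (hx : x ∈ resolvent (scale c A) z) (hy : y ∈ resolvent (scale c A) z) : x = y := by
  obtain ⟨_, ⟨u, hu, rfl⟩, rfl⟩ := hx
  obtain ⟨_, ⟨v, hv, rfl⟩, hxy⟩ := hy
  have hle : (c - ρ) * ‖u - v‖ ^ 2 ≤ 0 := by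
    simpa [hxy] using hA.mul_norm_sub_sq_le (η := c) hu hv
  have huv : u = v := by
    have := nonpos_of_mul_nonpos_right hle (sub_pos.2 hρ)
    rwa [sq_nonpos_iff, norm_eq_zero, sub_eq_zero] at this
  rwa [huv, add_left_inj] at hxy

theorem IsMaximallyCohypomonotone.mem (hA : IsMaximallyCohypomonotone ρ A)
    (h : ∀ x, ∀ u ∈ A x, -ρ * ‖w - u‖ ^ 2 ≤ inner ℝ (w - u) (z - x)) : w ∈ A z := by
  by_contra hw
  refine hA.2 (fun x => A x ∪ {u | x = z ∧ u = w}) ?_ ?_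
  · rintro x u y v (hu | ⟨rfl, rfl⟩) (hv | ⟨rfl, rfl⟩)
    · exact hA.1 x u y v hu hv
    · rw [norm_sub_rev, ← neg_sub v u, ← neg_sub y x, inner_neg_neg]
      exact h x u hu
    · exact h y v hv
    · simp
  · exact ⟨fun p hp => Or.inl hp, fun hsub => hw (hsub (a := (z, w)) (Or.inr ⟨rfl, rfl⟩))⟩

/-- Cohypomonotonicity says that the pairs `(x + ρ • u, y - (c - ρ) • u)` with `u ∈ A x` are
antimonotone. A point `z` compatible with all of them is `p + ρ • w` with `w ∈ A p`, by maximality,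
and `p` is the resolvent. -/
theorem IsMaximallyCohypomonotone.exists_mem_resolvent [CompleteSpace E]
    (hA : IsMaximallyCohypomonotone ρ A) (hρ : ρ < c) (y : E) :
    ∃ z, z ∈ resolvent (scale c A) y := by
  have hκ : 0 < c - ρ := sub_pos.2 hρ
  obtain ⟨z, hz⟩ := exists_forall_inner_sub_sub_nonpos
    (fun p : graph A => p.1.1 + ρ • p.1.2) (fun p => y - (c - ρ) • p.1.2) (by
      rintro ⟨⟨x, u⟩, hu⟩ ⟨⟨x', u'⟩, hu'⟩
      have h := hA.1.mul_norm_sub_sq_le (η := ρ) hu hu'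
      rw [sub_self, zero_mul] at h
      rw [sub_sub_sub_cancel_left, ← smul_sub, ← neg_sub u u', smul_neg, inner_neg_right,
        real_inner_smul_right, real_inner_comm]
      exact neg_nonpos.2 (mul_nonneg hκ.le h))
  obtain ⟨w, hw⟩ : ∃ w, y = z + (c - ρ) • w :=
    ⟨(c - ρ)⁻¹ • (y - z), by rw [smul_inv_smul₀ hκ.ne']; abel⟩
  have hmem : w ∈ A (z - ρ • w) := hA.mem fun x u hu => by
    have h := hz ⟨(x, u), hu⟩
    have hzc : z - (y - (c - ρ) • u) = -((c - ρ) • (w - u)) := by rw [hw]; module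
    rw [hzc, inner_neg_right, real_inner_smul_right, neg_nonpos, mul_nonneg_iff_of_pos_left hκ,
      real_inner_comm, ← sub_add_cancel z (ρ • w), inner_sub_add_smul_sub_add_smul] at h
    linarith
  exact ⟨z - ρ • w, c • w, ⟨w, hmem, rfl⟩, by rw [hw]; module⟩

theorem IsMaximallyCohypomonotone.existsUnique_mem_resolvent [CompleteSpace E]
    (hA : IsMaximallyCohypomonotone ρ A) (hρ : ρ < c) (y : E) :
    ∃! z, z ∈ resolvent (scale c A) y :=
  existsUnique_of_exists_of_unique (hA.exists_mem_resolvent hρ y)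
    fun _ _ => hA.1.eq_of_mem_resolvent hρ

theorem IsMaximallyMonotone.isMaximallyCohypomonotone (hA : IsMaximallyMonotone A) :
    IsMaximallyCohypomonotone 0 A := by
  simpa [IsMaximallyMonotone, IsMaximallyCohypomonotone, IsMonotone, IsCohypomonotone] using hA

end SetOp

namespace OracleProg

variable {E α : Type*} [NormedAddCommGroup E] [InnerProductSpace ℝ E] (F : E → E)
  (G : E → Set E)

@[simp] theorem value_pure (a : α) : value F G (pure a) = a := rfl

@[simp] theorem value_bind {α β : Type _} (p : OracleProg E α) (f : α → OracleProg E β) :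
    value F G (p >>= f) = value F G (f (value F G p)) := by
  induction p with
  | ret a => rfl
  | evalF _ _ ih => exact ih _
  | resolventG _ _ _ ih => exact ih _

@[simp] theorem countF_pure (a : α) : countF F G (pure a : OracleProg E α) = 0 := rfl

@[simp] theorem countF_queryF (x : E) : countF F G (queryF x) = 1 := rfl

@[simp] theorem countF_queryResolvent (c : ℝ) (y : E) : countF F G (queryResolvent c y) = 0 := rfl

@[simp] theorem countF_bind {α β : Type _} (p : OracleProg E α) (f : α → OracleProg E β) :
    countF F G (p >>= f) = countF F G p + countF F G (f (value F G p)) := by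
  induction p with
  | ret a => exact (Nat.zero_add _).symm
  | evalF _ _ ih => exact (congrArg (· + 1) (ih _)).trans (Nat.add_right_comm _ _ _)
  | resolventG _ _ _ ih => exact ih _

@[simp] theorem countResolvent_pure (a : α) :
    countResolvent F G (pure a : OracleProg E α) = 0 := rfl

@[simp] theorem countResolvent_queryF (x : E) : countResolvent F G (queryF x) = 0 := rfl

@[simp] theorem countResolvent_queryResolvent (c : ℝ) (y : E) :
    countResolvent F G (queryResolvent c y) = 1 := rfl

@[simp] theorem countResolvent_bind {α β : Type _} (p : OracleProg E α)
    (f : α → OracleProg E β) :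
    countResolvent F G (p >>= f) =
      countResolvent F G p + countResolvent F G (f (value F G p)) := by
  induction p with
  | ret a => exact (Nat.zero_add _).symm
  | evalF _ _ ih => exact ih _
  | resolventG _ _ _ ih => exact (congrArg (· + 1) (ih _)).trans (Nat.add_right_comm _ _ _)

end OracleProg

namespace Halpern

open OracleProg

section Programs

variable {E : Type*} [NormedAddCommGroup E] [InnerProductSpace ℝ E] (F : E → E) (G : E → Set E)
  (η L ρ : ℝ)

theorem countF_approxResolvent (N : ℕ) (x : E) :
    countF F G (approxResolvent η L N x) = 2 * N := by
  induction N with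
  | zero => rfl
  | succ N ih =>
    unfold approxResolvent at ih ⊢
    simp only [fbf, fbfStep, countF_bind, ih, countF_queryF, countF_pure, countF_queryResolvent]
    ring

theorem countResolvent_approxResolvent (N : ℕ) (x : E) :
    countResolvent F G (approxResolvent η L N x) = N := by
  induction N with
  | zero => rfl
  | succ N ih =>
    unfold approxResolvent at ih ⊢
    simp only [fbf, fbfStep, countResolvent_bind, ih, countResolvent_queryF,
      countResolvent_pure, countResolvent_queryResolvent]

theorem callsAt_eq (x₀ : E) (k : ℕ) :
    callsAt F G η L ρ x₀ k = 2 * innerIterations η L k := by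
  simp only [callsAt, oracleCalls, step, countF_bind, countResolvent_bind, countF_pure,
    countResolvent_pure, countF_approxResolvent, countResolvent_approxResolvent]
  omega

theorem iterate_succ (x₀ : E) (k : ℕ) :
    iterate F G η L ρ x₀ (k + 1) =
      (1 / ((k : ℝ) + 2)) • x₀ + (1 - 1 / ((k : ℝ) + 2)) •
        ((1 - (1 - ρ / η)) • iterate F G η L ρ x₀ k + (1 - ρ / η) •
          value F G (approxResolvent η L (innerIterations η L k) (iterate F G η L ρ x₀ k))) := by
  simp only [iterate, step, value_bind, value_pure]

variable {F G} in
theorem value_fbf_succ {z₀ : E} {B : E → E} {JA : ℝ → E → OracleProg E E}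
    {Bin : E → OracleProg E E} (hB : ∀ z, value F G (Bin z) - z₀ = B z) (LB : ℝ) (t : ℕ) :
    let τ := 1 / (2 * LB)
    let z := value F G (fbf z₀ t JA Bin LB)
    let h := value F G (JA τ (z - τ • B z))
    value F G (fbf z₀ (t + 1) JA Bin LB) = h + τ • B z - τ • B h := by
  simp only [fbf, fbfStep, value_bind, value_pure, hB]

end Programs

section ForwardBackwardForward

variable {E : Type*} [NormedAddCommGroup E] [InnerProductSpace ℝ E]

/-- Strong monotonicity with modulus `μ`, the property of `Id + η F - x` that makes the
forward-backward-forward steps contract. -/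
def StronglyMonotone (μ : ℝ) (B : E → E) : Prop :=
  ∀ x y, μ * ‖x - y‖ ^ 2 ≤ inner ℝ (B x - B y) (x - y)

theorem norm_sub_sq_eq_sub_add_sub_inner (z z' h s : E) :
    ‖z' - s‖ ^ 2 =
      ‖z - s‖ ^ 2 - ‖z - h‖ ^ 2 + ‖z' - h‖ ^ 2 - 2 * inner ℝ (z - z') (h - s) := by
  rw [← sub_add_sub_cancel z' h s, ← sub_add_sub_cancel z h s, norm_add_sq_real, norm_add_sq_real,
    ← sub_sub_sub_cancel_right z z' h, inner_sub_left (z - h)]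
  ring

theorem add_three_mul_exp_half_le {q : ℝ} (hq₀ : 0 ≤ q) (hq₁ : q ≤ 1) :
    (q + 3) * Real.exp (q / 2) ≤ 4 * q + 3 := by
  have hexp : Real.exp (q / 2) ≤ 1 + q / 2 + (q / 2) ^ 2 := by
    have := Real.abs_exp_sub_one_sub_id_le (x := q / 2) (by rw [abs_of_nonneg] <;> linarith)
    linarith [(abs_le.1 this).2]
  calc (q + 3) * Real.exp (q / 2) ≤ (q + 3) * (1 + q / 2 + (q / 2) ^ 2) := by gcongr
    _ ≤ 4 * q + 3 := by nlinarith [mul_nonneg hq₀ hq₀, mul_nonneg hq₀ (sub_nonneg.2 hq₁)]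

theorem sq_sub_sq_sub_sq_le_exp_mul_sq {q p t D : ℝ} (hq₀ : 0 ≤ q) (hq₁ : q ≤ 1) (hD₀ : 0 ≤ D)
    (hD : D ≤ p + t) :
    D ^ 2 - 3 / 4 * p ^ 2 - q * t ^ 2 ≤ Real.exp (-(q / 2)) * D ^ 2 := by
  have hcauchy : 3 * q * (p + t) ^ 2 ≤ (4 * q + 3) * (3 / 4 * p ^ 2 + q * t ^ 2) := by
    linarith [sq_nonneg (3 * p - 4 * q * t)]
  have hsq : D ^ 2 ≤ (p + t) ^ 2 := by gcongr
  have hcontr : (4 * q + 3) * (D ^ 2 - 3 / 4 * p ^ 2 - q * t ^ 2) ≤ (q + 3) * D ^ 2 := by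
    linarith [mul_le_mul_of_nonneg_left hsq (by positivity : 0 ≤ 3 * q)]
  have hexp : q + 3 ≤ (4 * q + 3) * Real.exp (-(q / 2)) := by
    rw [Real.exp_neg, ← div_eq_mul_inv, le_div_iff₀ (Real.exp_pos _)]
    exact add_three_mul_exp_half_le hq₀ hq₁
  refine le_of_mul_le_mul_left (hcontr.trans ?_) (by positivity : 0 < 4 * q + 3)
  rw [← mul_assoc]
  gcongr

variable {A : E → Set E} {B : E → E} {μ : ℝ} {ℓ : ℝ≥0} {s z h : E}

theorem norm_fbf_sub_sq_le (hA : SetOp.IsMonotone A) (hB : StronglyMonotone μ B)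
    (hlip : LipschitzWith ℓ B) (hμ : 0 ≤ μ) (hℓ : 0 < ℓ) (hμℓ : μ ≤ ℓ) (hs : -B s ∈ A s)
    (hh : h ∈ SetOp.resolvent (SetOp.scale (1 / (2 * (ℓ : ℝ))) A)
      (z - (1 / (2 * (ℓ : ℝ))) • B z)) :
    ‖h + (1 / (2 * (ℓ : ℝ))) • B z - (1 / (2 * (ℓ : ℝ))) • B h - s‖ ^ 2 ≤
      Real.exp (-(μ / ℓ / 2)) * ‖z - s‖ ^ 2 := by
  have hℓ' : (0 : ℝ) < ℓ := hℓ
  obtain ⟨_, ⟨a, ha, rfl⟩, hz⟩ := hh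
  set τ : ℝ := 1 / (2 * ℓ) with hτ
  set z' := h + τ • B z - τ • B h with hz'
  have hcorr : ‖z' - h‖ ≤ 1 / 2 * ‖z - h‖ := by
    have hdiff : z' - h = τ • (B z - B h) := by rw [hz']; module
    rw [hdiff, norm_smul, Real.norm_of_nonneg (by positivity : 0 ≤ τ)]
    calc τ * ‖B z - B h‖ ≤ τ * (ℓ * ‖z - h‖) := by gcongr; exact hlip.norm_sub_le z h
      _ = 1 / 2 * ‖z - h‖ := by rw [hτ]; field_simp
  have hmono : μ / ℓ * ‖h - s‖ ^ 2 ≤ 2 * inner ℝ (z - z') (h - s) := by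
    have hdiff : z - z' = τ • ((a - -B s) + (B h - B s)) := by
      rw [hz']
      linear_combination (norm := module) hz
    rw [hdiff, real_inner_smul_left, inner_add_left]
    calc μ / ℓ * ‖h - s‖ ^ 2 = 2 * (τ * (μ * ‖h - s‖ ^ 2)) := by rw [hτ]; field_simp
      _ ≤ _ := by gcongr; linarith [hA h a s _ ha hs, hB h s]
  calc ‖z' - s‖ ^ 2 ≤ ‖z - s‖ ^ 2 - 3 / 4 * ‖z - h‖ ^ 2 - μ / ℓ * ‖h - s‖ ^ 2 := by
        have := pow_le_pow_left₀ (norm_nonneg _) hcorr 2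
        linarith [norm_sub_sq_eq_sub_add_sub_inner z z' h s]
    _ ≤ _ := sq_sub_sq_sub_sq_le_exp_mul_sq (by positivity) ((div_le_one hℓ').2 hμℓ)
        (norm_nonneg _) (norm_sub_le_norm_sub_add_norm_sub _ _ _)

variable {F : E → E} {G : E → Set E} {z₀ : E} {JA : ℝ → E → OracleProg E E}
  {Bin : E → OracleProg E E}

theorem norm_value_fbf_sub_sq_le (hA : SetOp.IsMonotone A) (hB : StronglyMonotone μ B)
    (hlip : LipschitzWith ℓ B) (hμ : 0 ≤ μ) (hℓ : 0 < ℓ) (hμℓ : μ ≤ ℓ) (hs : -B s ∈ A s)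
    (hJA : ∀ y, value F G (JA (1 / (2 * (ℓ : ℝ))) y) ∈
      SetOp.resolvent (SetOp.scale (1 / (2 * (ℓ : ℝ))) A) y)
    (hBin : ∀ z, value F G (Bin z) - z₀ = B z) (N : ℕ) :
    ‖value F G (fbf z₀ N JA Bin ℓ) - s‖ ^ 2 ≤ Real.exp (-(μ / ℓ / 2)) ^ N * ‖z₀ - s‖ ^ 2 := by
  induction N with
  | zero => simp [fbf]
  | succ N ih =>
    rw [value_fbf_succ hBin]
    refine (norm_fbf_sub_sq_le hA hB hlip hμ hℓ hμℓ hs (hJA _)).trans ?_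
    rw [pow_succ' (Real.exp _), mul_assoc]
    gcongr

theorem exp_pow_le_inv_sq_of_log_le {μ ℓ M : ℝ} (hμ : 0 < μ) (hℓ : 0 < ℓ) (hM : 0 < M) {N : ℕ}
    (hN : 4 * ℓ / μ * Real.log M ≤ N) : Real.exp (-(μ / ℓ / 2)) ^ N ≤ M⁻¹ ^ 2 := by
  rw [← Real.exp_nat_mul, ← Real.exp_log (inv_pos.2 hM), ← Real.exp_nat_mul, Real.exp_le_exp,
    Real.log_inv]
  calc N * -(μ / ℓ / 2) ≤ 4 * ℓ / μ * Real.log M * -(μ / ℓ / 2) :=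
        mul_le_mul_of_nonpos_right hN (neg_nonpos.2 (by positivity))
    _ = (2 : ℕ) * -Real.log M := by field_simp; norm_num; ring

theorem norm_value_fbf_sub_le (hA : SetOp.IsMonotone A) (hB : StronglyMonotone μ B)
    (hlip : LipschitzWith ℓ B) (hμ : 0 < μ) (hμℓ : μ ≤ ℓ) (hs : -B s ∈ A s)
    (hJA : ∀ y, value F G (JA (1 / (2 * (ℓ : ℝ))) y) ∈
      SetOp.resolvent (SetOp.scale (1 / (2 * (ℓ : ℝ))) A) y)
    (hBin : ∀ z, value F G (Bin z) - z₀ = B z) {M : ℝ} (hM : 0 < M) {N : ℕ}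
    (hN : 4 * ℓ / μ * Real.log M ≤ N) :
    ‖value F G (fbf z₀ N JA Bin ℓ) - s‖ ≤ M⁻¹ * ‖z₀ - s‖ := by
  have hℓ : (0 : ℝ) < ℓ := hμ.trans_le hμℓ
  refine le_of_sq_le_sq ?_ (by positivity)
  rw [mul_pow]
  exact (norm_value_fbf_sub_sq_le hA hB hlip hμ.le hℓ hμℓ hs hJA hBin N).trans
    (mul_le_mul_of_nonneg_right (exp_pow_le_inv_sq_of_log_le hμ hℓ hM hN) (sq_nonneg _))

end ForwardBackwardForward

section ApproxResolvent

variable {E : Type*} [NormedAddCommGroup E] [InnerProductSpace ℝ E] {F : E → E} {G : E → Set E}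
  {L η : ℝ≥0}

theorem stronglyMonotone_add_smul_sub (hF : LipschitzWith L F) (x : E) :
    StronglyMonotone (1 - η * L) fun z => z + (η : ℝ) • F z - x := by
  intro y w
  have hinner : -(L * ‖y - w‖ ^ 2) ≤ inner ℝ (F y - F w) (y - w) := by
    have hcs := (abs_le.1 (abs_real_inner_le_norm (F y - F w) (y - w))).1
    have := mul_le_mul_of_nonneg_right (hF.norm_sub_le y w) (norm_nonneg (y - w))
    linarith
  calc (1 - η * L) * ‖y - w‖ ^ 2 = ‖y - w‖ ^ 2 + η * -(L * ‖y - w‖ ^ 2) := by ring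
    _ ≤ ‖y - w‖ ^ 2 + η * inner ℝ (F y - F w) (y - w) := by gcongr
    _ = _ := by
      rw [← real_inner_self_eq_norm_sq, ← real_inner_smul_left, ← inner_add_left]
      congr 1
      module

theorem lipschitzWith_add_smul_sub (hF : LipschitzWith L F) (x : E) :
    LipschitzWith (1 + η * L) fun z => z + (η : ℝ) • F z - x := by
  have hsmul : LipschitzWith (η * L) fun z => (η : ℝ) • F z := by
    simpa [Function.comp_def] using (lipschitzWith_smul (η : ℝ)).comp hF
  simpa using (LipschitzWith.id.add hsmul).sub (LipschitzWith.const x)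

theorem norm_value_approxResolvent_sub_le (hη : 0 < η) (hηL : η * L < 1) (hF : LipschitzWith L F)
    (hG : SetOp.IsMonotone G)
    (hJ : ∀ c : ℝ, 0 < c → ∀ y, ∃ z, z ∈ SetOp.resolvent (SetOp.scale c G) y) {x s : E}
    (hs : s ∈ SetOp.resolvent (SetOp.scale (η : ℝ) (SetOp.add F G)) x) {M : ℝ} (hM : 0 < M) {N : ℕ}
    (hN : 4 * (1 + η * L) / (1 - η * L) * Real.log M ≤ (N : ℝ)) :
    ‖value F G (approxResolvent η L N x) - s‖ ≤ M⁻¹ * ‖x - s‖ := by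
  have hηL' : (η : ℝ) * L < 1 := mod_cast hηL
  have hηL₀ : (0 : ℝ) ≤ η * L := by positivity
  have h := norm_value_fbf_sub_le (F := F) (G := G) (z₀ := x)
    (JA := fun τ y => queryResolvent (τ * η) y) (Bin := fun z => do
      let v ← queryF z
      return z + (η : ℝ) • v) (hG.scale η.coe_nonneg) (stronglyMonotone_add_smul_sub hF x)
    (lipschitzWith_add_smul_sub hF x) (sub_pos.2 hηL') (by push_cast; linarith)
    (SetOp.mem_resolvent_scale_add_iff.1 hs) (fun y => ?_) (fun z => ?_) hM (N := N)
    (by simpa using hN)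
  · simpa [approxResolvent] using h
  · rw [SetOp.scale_scale]
    exact SetOp.resolventMap_mem (hJ _ (by positivity) _)
  · rfl

end ApproxResolvent

section Tolerance

/-- The relative accuracy `1 / (98 √(k+2) log (k+2))` that the `N_k` inner iterations guarantee for
the resolvent computed in iteration `k`. -/
noncomputable def tolerance (k : ℕ) : ℝ := (98 * Real.sqrt ((k : ℝ) + 2) * Real.log ((k : ℝ) + 2))⁻¹

theorem half_le_log_add_two (k : ℕ) : 1 / 2 ≤ Real.log ((k : ℝ) + 2) :=
  calc (1 / 2 : ℝ) ≤ Real.log 2 := by linarith [Real.log_two_gt_d9]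
    _ ≤ Real.log ((k : ℝ) + 2) := Real.log_le_log two_pos (by simp)

theorem tolerance_pos (k : ℕ) : 0 < tolerance k := by
  have := one_half_pos.trans_le (half_le_log_add_two k)
  unfold tolerance
  positivity

theorem one_div_mul_log_sq_le {x : ℝ} (hx : 1 < x) :
    1 / ((x + 1) * Real.log (x + 1) ^ 2) ≤ 1 / Real.log x - 1 / Real.log (x + 1) := by
  have hlog : 0 < Real.log x := Real.log_pos hx
  have hlog_le : Real.log x ≤ Real.log (x + 1) := Real.log_le_log (by linarith) (by linarith)
  have hdiff : 1 / (x + 1) ≤ Real.log (x + 1) - Real.log x := by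
    rw [← Real.log_div (by linarith) (by linarith)]
    refine le_of_eq_of_le ?_ (Real.one_sub_inv_le_log_of_pos (by positivity))
    field_simp
    ring
  have hlog' := hlog.trans_le hlog_le
  calc 1 / ((x + 1) * Real.log (x + 1) ^ 2)
      = 1 / (x + 1) * (1 / (Real.log (x + 1) * Real.log (x + 1))) := by field_simp
    _ ≤ (Real.log (x + 1) - Real.log x) * (1 / (Real.log x * Real.log (x + 1))) := by gcongr
    _ = 1 / Real.log x - 1 / Real.log (x + 1) := by field_simp

theorem one_div_mul_sqrt_le {x : ℝ} (hx : 1 ≤ x) :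
    1 / (x * Real.sqrt (x + 1)) ≤ 3 / Real.sqrt x - 3 / Real.sqrt (x + 1) := by
  set a := Real.sqrt x
  set b := Real.sqrt (x + 1)
  have ha : a ^ 2 = x := Real.sq_sqrt (by linarith)
  have hb : b ^ 2 = x + 1 := Real.sq_sqrt (by linarith)
  have ha₀ : 0 < a := Real.sqrt_pos.2 (by linarith)
  have hb₀ : 0 < b := Real.sqrt_pos.2 (by linarith)
  have hab : a ≤ b := Real.sqrt_le_sqrt (by linarith)
  have hba : b ≤ 2 * a := le_of_sq_le_sq (by linarith) (by positivity)
  have hdiff : 1 ≤ 3 * a * (b - a) := by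
    linarith [mul_le_mul_of_nonneg_right hba (sub_nonneg.2 hab)]
  calc 1 / (x * b) ≤ 3 * a * (b - a) / (x * b) := by gcongr
    _ = 3 / a - 3 / b := by rw [← ha]; field_simp

theorem sum_one_div_mul_log_sq_le (n : ℕ) :
    ∑ k ∈ Finset.range n, 1 / (((k : ℝ) + 2) * Real.log ((k : ℝ) + 2) ^ 2) ≤ 4 := by
  have htelescope :
      ∑ k ∈ Finset.range n, 1 / (((k : ℝ) + 2 + 1) * Real.log ((k : ℝ) + 2 + 1) ^ 2) ≤
        1 / Real.log 2 - 1 / Real.log ((n : ℝ) + 2) := by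
    have hsum := Finset.sum_range_sub' (fun k : ℕ => 1 / Real.log ((k : ℝ) + 2)) n
    push_cast at hsum
    simp only [zero_add, add_right_comm _ (1 : ℝ) 2] at hsum
    rw [← hsum]
    exact Finset.sum_le_sum fun k _ =>
      one_div_mul_log_sq_le (by linarith [k.cast_nonneg (α := ℝ)])
  have hfirst : 1 / (2 * Real.log 2 ^ 2) + 1 / Real.log 2 ≤ 4 := by
    have hlog := Real.log_two_gt_d9
    calc 1 / (2 * Real.log 2 ^ 2) + 1 / Real.log 2 ≤ 1 / (2 * 0.69 ^ 2) + 1 / 0.69 := by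
          gcongr <;> linarith
      _ ≤ 4 := by norm_num
  have hlast : 0 ≤ 1 / Real.log ((n : ℝ) + 2) :=
    one_div_nonneg.2 (one_half_pos.le.trans (half_le_log_add_two n))
  calc _ ≤ ∑ k ∈ Finset.range (n + 1), 1 / (((k : ℝ) + 2) * Real.log ((k : ℝ) + 2) ^ 2) :=
        Finset.sum_le_sum_of_subset_of_nonneg (Finset.range_subset_range.2 n.le_succ)
          fun _ _ _ => by positivity
    _ = ∑ k ∈ Finset.range n, 1 / (((k : ℝ) + 2 + 1) * Real.log ((k : ℝ) + 2 + 1) ^ 2) +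
        1 / (2 * Real.log 2 ^ 2) := by
      rw [Finset.sum_range_succ']
      push_cast
      simp only [zero_add, add_right_comm _ (1 : ℝ) 2]
    _ ≤ 4 := by linarith

theorem sum_one_div_mul_sqrt_le (n : ℕ) :
    ∑ k ∈ Finset.range n, 1 / (((k : ℝ) + 1) * Real.sqrt ((k : ℝ) + 2)) ≤ 3 := by
  have hsum := Finset.sum_range_sub' (fun k : ℕ => 3 / Real.sqrt ((k : ℝ) + 1)) n
  push_cast at hsum
  simp only [add_assoc, one_add_one_eq_two, zero_add, Real.sqrt_one, div_one] at hsum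
  calc _ ≤ ∑ k ∈ Finset.range n, (3 / Real.sqrt ((k : ℝ) + 1) - 3 / Real.sqrt ((k : ℝ) + 2)) := by
        refine Finset.sum_le_sum fun k _ => ?_
        simpa only [add_assoc, one_add_one_eq_two] using
          one_div_mul_sqrt_le (x := (k : ℝ) + 1) (by simp)
    _ = 3 - 3 / Real.sqrt ((n : ℝ) + 1) := hsum
    _ ≤ 3 := sub_le_self _ (by positivity)

theorem sum_tolerance_le (n : ℕ) :
    ∑ k ∈ Finset.range n, (tolerance k ^ 2 + tolerance k / ((k : ℝ) + 1)) ≤ 1 / 4 := by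
  have hterm : ∀ k : ℕ, tolerance k ^ 2 + tolerance k / ((k : ℝ) + 1) ≤
      1 / 98 ^ 2 * (1 / (((k : ℝ) + 2) * Real.log ((k : ℝ) + 2) ^ 2)) +
        1 / 49 * (1 / (((k : ℝ) + 1) * Real.sqrt ((k : ℝ) + 2))) := fun k => by
    have hlog := half_le_log_add_two k
    refine add_le_add (le_of_eq ?_) ?_
    · rw [tolerance, inv_pow, mul_pow, mul_pow, Real.sq_sqrt (by positivity)]
      field_simp
    · calc tolerance k / ((k : ℝ) + 1)
          ≤ (98 * Real.sqrt ((k : ℝ) + 2) * (1 / 2))⁻¹ / ((k : ℝ) + 1) := by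
            unfold tolerance; gcongr
        _ = _ := by field_simp; norm_num
  calc _ ≤ _ := Finset.sum_le_sum fun k _ => hterm k
    _ ≤ 1 / 98 ^ 2 * 4 + 1 / 49 * 3 := by
      rw [Finset.sum_add_distrib, ← Finset.mul_sum, ← Finset.mul_sum]
      gcongr
      exacts [sum_one_div_mul_log_sq_le n, sum_one_div_mul_sqrt_le n]
    _ ≤ 1 / 4 := by norm_num

end Tolerance

section Potential

variable {E : Type*} [NormedAddCommGroup E] [InnerProductSpace ℝ E]

/-- Firm nonexpansiveness. It is used for residuals `R = Id - T`, since `T` is firmly nonexpansive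
exactly when `R` is. -/
def FirmlyNonexpansive (R : E → E) : Prop :=
  ∀ x y, ‖R x - R y‖ ^ 2 ≤ inner ℝ (R x - R y) (x - y)

/-- The potential of the Halpern iteration for `Id - R` anchored at `x₀`, at the iterate `x` of
index `k`. -/
noncomputable def potential (R : E → E) (x₀ : E) (k : ℕ) (x : E) : ℝ :=
  ((k : ℝ) + 1) * k / 2 * ‖R x‖ ^ 2 + ((k : ℝ) + 1) * inner ℝ (R x) (x - x₀)

variable {R : E → E} {x₀ p x x' e : E} {k : ℕ}

theorem FirmlyNonexpansive.mul_norm_le_of_potential_le (hR : FirmlyNonexpansive R) (hp : R p = 0)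
    (h : potential R x₀ k x ≤ 4 * ‖x₀ - p‖ ^ 2) : ((k : ℝ) + 1) * ‖R x‖ ≤ 4 * ‖x₀ - p‖ := by
  have hinner : ‖R x‖ ^ 2 - ‖R x‖ * ‖x₀ - p‖ ≤ inner ℝ (R x) (x - x₀) := by
    have hfirm : ‖R x‖ ^ 2 ≤ inner ℝ (R x) (x - p) := by simpa only [hp, sub_zero] using hR x p
    rw [← sub_sub_sub_cancel_right x x₀ p, inner_sub_right]
    linarith [real_inner_le_norm (R x) (x₀ - p)]
  have hlower : (((k : ℝ) + 1) * ‖R x‖) ^ 2 / 2 - ((k : ℝ) + 1) * ‖R x‖ * ‖x₀ - p‖ ≤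
      potential R x₀ k x := by
    have := mul_le_mul_of_nonneg_left hinner (by positivity : 0 ≤ (k : ℝ) + 1)
    have hsq : 0 ≤ ((k : ℝ) + 1) * ‖R x‖ ^ 2 := by positivity
    unfold potential
    linarith
  by_contra! hlt
  nlinarith [norm_nonneg (x₀ - p)]

theorem FirmlyNonexpansive.potential_succ_le (hR : FirmlyNonexpansive R)
    (hx' : x' = (1 / ((k : ℝ) + 2)) • x₀ + (1 - 1 / ((k : ℝ) + 2)) • (x - R x + e)) :
    potential R x₀ (k + 1) x' ≤ potential R x₀ k x +
      (((k : ℝ) + 1) * (k + 2) / 2 * ‖e‖ ^ 2 + ((k : ℝ) + 1) * inner ℝ (R x) e) := by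
  have hk : (k : ℝ) + 2 ≠ 0 := by positivity
  have hanchor : ((k : ℝ) + 2) • (x' - x₀) = ((k : ℝ) + 1) • (x - x₀ - R x + e) := by
    rw [hx']
    match_scalars <;> field_simp <;> ring
  have hmove : ((k : ℝ) + 2) • (x' - x) = ((k : ℝ) + 1) • (e - R x) - (x - x₀) := by
    linear_combination (norm := module) hanchor
  have hfirm := mul_le_mul_of_nonneg_left (hR x' x)
    (by positivity : 0 ≤ ((k : ℝ) + 1) * ((k : ℝ) + 2))
  rw [mul_assoc _ _ (inner ℝ _ _), ← real_inner_smul_right, hmove] at hfirm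
  have hsq : 0 ≤ ((k : ℝ) + 1) * (k + 2) / 2 * ‖R x' - R x - e‖ ^ 2 := by positivity
  unfold potential
  push_cast
  rw [add_assoc (k : ℝ) 1 1, one_add_one_eq_two, ← real_inner_smul_right _ (x' - x₀), hanchor]
  generalize x - x₀ = w at *
  simp only [← real_inner_self_eq_norm_sq, inner_sub_left, inner_sub_right, inner_add_right,
    real_inner_smul_right, real_inner_comm (R x) (R x'), real_inner_comm e (R x'),
    real_inner_comm e (R x)] at hfirm hsq ⊢
  linarith

theorem FirmlyNonexpansive.potential_succ_le_of_norm_le (hR : FirmlyNonexpansive R)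
    (hx' : x' = (1 / ((k : ℝ) + 2)) • x₀ + (1 - 1 / ((k : ℝ) + 2)) • (x - R x + e)) {ε : ℝ}
    (he : ‖e‖ ≤ ε * ‖R x‖) :
    potential R x₀ (k + 1) x' ≤
      potential R x₀ k x + (((k : ℝ) + 1) * ‖R x‖) ^ 2 * (ε ^ 2 + ε / ((k : ℝ) + 1)) := by
  have hsq : ‖e‖ ^ 2 ≤ (ε * ‖R x‖) ^ 2 := by gcongr
  have hinner : inner ℝ (R x) e ≤ ‖R x‖ * (ε * ‖R x‖) :=
    (real_inner_le_norm _ _).trans (by gcongr)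
  refine (hR.potential_succ_le hx').trans (add_le_add_right ?_ _)
  calc ((k : ℝ) + 1) * (k + 2) / 2 * ‖e‖ ^ 2 + ((k : ℝ) + 1) * inner ℝ (R x) e
      ≤ ((k : ℝ) + 1) ^ 2 * (ε * ‖R x‖) ^ 2 + ((k : ℝ) + 1) * (‖R x‖ * (ε * ‖R x‖)) := by
        gcongr
        nlinarith [k.cast_nonneg (α := ℝ)]
    _ = (((k : ℝ) + 1) * ‖R x‖) ^ 2 * (ε ^ 2 + ε / ((k : ℝ) + 1)) := by field_simp

theorem FirmlyNonexpansive.mul_norm_le_of_inexact_halpern (hR : FirmlyNonexpansive R) (hp : R p = 0)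
    {x e : ℕ → E} {ε : ℕ → ℝ}
    (hstep : ∀ k : ℕ, x (k + 1) =
      (1 / ((k : ℝ) + 2)) • x 0 + (1 - 1 / ((k : ℝ) + 2)) • (x k - R (x k) + e k))
    (he : ∀ k, ‖e k‖ ≤ ε k * ‖R (x k)‖) (hε : ∀ k, 0 ≤ ε k)
    (hsum : ∀ n, ∑ k ∈ Finset.range n, (ε k ^ 2 + ε k / ((k : ℝ) + 1)) ≤ 1 / 4) (k : ℕ) :
    ((k : ℝ) + 1) * ‖R (x k)‖ ≤ 4 * ‖x 0 - p‖ := by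
  have hbound : ∀ k : ℕ, potential R (x 0) k (x k) ≤
      (4 * ‖x 0 - p‖) ^ 2 * ∑ j ∈ Finset.range k, (ε j ^ 2 + ε j / ((j : ℝ) + 1)) →
      ((k : ℝ) + 1) * ‖R (x k)‖ ≤ 4 * ‖x 0 - p‖ := fun k h =>
    hR.mul_norm_le_of_potential_le hp <| h.trans <|
      calc _ ≤ (4 * ‖x 0 - p‖) ^ 2 * (1 / 4) := by gcongr; exact hsum k
        _ = 4 * ‖x 0 - p‖ ^ 2 := by ring
  refine hbound k ?_
  induction k with
  | zero => simp [potential]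
  | succ k ih =>
    have := hε k
    have := hbound k ih
    rw [Finset.sum_range_succ, mul_add]
    exact (hR.potential_succ_le_of_norm_le (hstep k) (he k)).trans (add_le_add ih (by gcongr))

end Potential

section RelaxedResidual

variable {E : Type*} [NormedAddCommGroup E] [InnerProductSpace ℝ E] {A : E → Set E} {ρ η : ℝ}

/-- The residual `x - T x` of the relaxed resolvent `T = (1 - α) Id + α J_{ηA}` with
`α = 1 - ρ / η`. -/
noncomputable def relaxedResidual (A : E → Set E) (ρ η : ℝ) (x : E) : E :=
  (1 - ρ / η) • (x - SetOp.resolventMap (SetOp.scale η A) x)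

theorem exists_relaxedResidual_eq (hη : η ≠ 0) {x : E}
    (h : ∃ y, y ∈ SetOp.resolvent (SetOp.scale η A) x) :
    ∃ z, ∃ u ∈ A z, x = z + η • u ∧ relaxedResidual A ρ η x = (η - ρ) • u := by
  obtain ⟨_, ⟨u, hu, rfl⟩, hx⟩ := SetOp.resolventMap_mem h
  refine ⟨_, u, hu, hx, ?_⟩
  rw [relaxedResidual, sub_eq_of_eq_add' hx, smul_smul, sub_mul, div_mul_cancel₀ _ hη, one_mul]

theorem firmlyNonexpansive_relaxedResidual (hA : SetOp.IsCohypomonotone ρ A) (hη : η ≠ 0)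
    (hρη : ρ ≤ η) (hJ : ∀ x, ∃ y, y ∈ SetOp.resolvent (SetOp.scale η A) x) :
    FirmlyNonexpansive (relaxedResidual A ρ η) := by
  intro x y
  obtain ⟨z, u, hu, hx, hRx⟩ := exists_relaxedResidual_eq (ρ := ρ) hη (hJ x)
  obtain ⟨w, v, hv, hy, hRy⟩ := exists_relaxedResidual_eq (ρ := ρ) hη (hJ y)
  have hκ : 0 ≤ η - ρ := sub_nonneg.2 hρη
  rw [hRx, hRy, ← smul_sub, norm_smul, Real.norm_of_nonneg hκ, real_inner_smul_left, hx, hy]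
  calc ((η - ρ) * ‖u - v‖) ^ 2 = (η - ρ) * ((η - ρ) * ‖u - v‖ ^ 2) := by ring
    _ ≤ _ := by gcongr; exact hA.mul_norm_sub_sq_le hu hv

theorem relaxedResidual_eq_zero (hA : SetOp.IsCohypomonotone ρ A) (hρη : ρ < η) {p : E}
    (hp : 0 ∈ A p) : relaxedResidual A ρ η p = 0 := by
  have hmem : p ∈ SetOp.resolvent (SetOp.scale η A) p := ⟨0, ⟨0, hp, by simp⟩, by simp⟩
  rw [relaxedResidual, hA.eq_of_mem_resolvent hρη (SetOp.resolventMap_mem ⟨p, hmem⟩) hmem,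
    sub_self, smul_zero]

end RelaxedResidual

section Rate

variable {E : Type*} [NormedAddCommGroup E] [InnerProductSpace ℝ E] {F : E → E} {G : E → Set E}
  {L : ℝ≥0} {η ρ : ℝ}

theorem norm_value_approxResolvent_innerIterations_sub_le (hη : 0 < η) (hηL : η * L < 1)
    (hF : LipschitzWith L F) (hG : SetOp.IsMonotone G)
    (hJ : ∀ c : ℝ, 0 < c → ∀ y, ∃ z, z ∈ SetOp.resolvent (SetOp.scale c G) y) {x s : E}
    (hs : s ∈ SetOp.resolvent (SetOp.scale η (SetOp.add F G)) x) (k : ℕ) :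
    ‖value F G (approxResolvent η L (innerIterations η L k) x) - s‖ ≤ tolerance k * ‖x - s‖ := by
  lift η to ℝ≥0 using hη.le
  have hN : 4 * (1 + η * L) / (1 - η * L) * Real.log (tolerance k)⁻¹ ≤
      innerIterations η L k := by
    rw [tolerance, inv_inv]
    exact Nat.le_ceil _
  simpa only [inv_inv] using norm_value_approxResolvent_sub_le (mod_cast hη) (mod_cast hηL) hF hG
    hJ hs (inv_pos.2 (tolerance_pos k)) hN

theorem mul_norm_relaxedResidual_iterate_le (hη : 0 < η) (hηL : η * L < 1) (hρη : ρ < η)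
    (hF : LipschitzWith L F) (hG : SetOp.IsMonotone G)
    (hJG : ∀ c : ℝ, 0 < c → ∀ y, ∃ z, z ∈ SetOp.resolvent (SetOp.scale c G) y)
    (hFG : SetOp.IsCohypomonotone ρ (SetOp.add F G))
    (hJ : ∀ y, ∃ z, z ∈ SetOp.resolvent (SetOp.scale η (SetOp.add F G)) y)
    {p : E} (hp : 0 ∈ SetOp.add F G p) (x₀ : E) (k : ℕ) :
    ((k : ℝ) + 1) * ‖relaxedResidual (SetOp.add F G) ρ η (iterate F G η L ρ x₀ k)‖ ≤
      4 * ‖x₀ - p‖ := by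
  let x := iterate F G η L ρ x₀
  let J : ℕ → E := fun k => value F G (approxResolvent η L (innerIterations η L k) (x k))
  let s : ℕ → E := fun k => SetOp.resolventMap (SetOp.scale η (SetOp.add F G)) (x k)
  have : 0 ≤ 1 - ρ / η := sub_nonneg.2 ((div_le_one hη).2 hρη.le)
  refine (firmlyNonexpansive_relaxedResidual hFG hη.ne' hρη.le hJ).mul_norm_le_of_inexact_halpern
    (relaxedResidual_eq_zero hFG hρη hp) (x := x) (e := fun k => (1 - ρ / η) • (J k - s k))
    (ε := tolerance) (fun k => ?_) (fun k => ?_) (fun k => (tolerance_pos k).le)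
    sum_tolerance_le k
  · rw [show x (k + 1) = _ from iterate_succ F G η L ρ x₀ k]
    congr 2
    simp only [relaxedResidual, s]
    module
  · rw [relaxedResidual, norm_smul, norm_smul, mul_left_comm]
    gcongr
    exact norm_value_approxResolvent_innerIterations_sub_le hη hηL hF hG hJG
      (SetOp.resolventMap_mem (hJ (x k))) k

theorem norm_sub_resolventMap_sq_le_of_mul_norm_relaxedResidual_le {A : E → Set E} (hη : 0 < η)
    (hρη : ρ < η) {x : E} {c D : ℝ} (hc : 0 < c) (h : c * ‖relaxedResidual A ρ η x‖ ≤ 4 * D) :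
    1 / η ^ 2 * ‖x - SetOp.resolventMap (SetOp.scale η A) x‖ ^ 2 ≤
      16 * D ^ 2 / ((η - ρ) ^ 2 * c ^ 2) := by
  have hκ : 0 < η - ρ := sub_pos.2 hρη
  have hα : 0 ≤ 1 - ρ / η := sub_nonneg.2 ((div_le_one hη).2 hρη.le)
  rw [relaxedResidual, norm_smul, Real.norm_of_nonneg hα] at h
  rw [le_div_iff₀ (by positivity)]
  calc 1 / η ^ 2 * ‖x - SetOp.resolventMap (SetOp.scale η A) x‖ ^ 2 * ((η - ρ) ^ 2 * c ^ 2)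
      = (c * ((1 - ρ / η) * ‖x - SetOp.resolventMap (SetOp.scale η A) x‖)) ^ 2 := by
        field_simp
    _ ≤ (4 * D) ^ 2 := by gcongr
    _ = 16 * D ^ 2 := by ring

end Rate

end Halpern

theorem theorem1_general {E : Type*} [NormedAddCommGroup E] [InnerProductSpace ℝ E]
    [CompleteSpace E] {F : E → E} {G : E → Set E} {L : ℝ≥0} {η ρ : ℝ} (hF : LipschitzWith L F)
    (hG : SetOp.IsMaximallyMonotone G)
    (hFG : SetOp.IsMaximallyCohypomonotone ρ (SetOp.add F G)) (hη : 0 < η) (hρη : ρ < η)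
    (hηL : η * L < 1) {p : E} (hp : 0 ∈ SetOp.add F G p) (x₀ : E) :
    (∀ c : ℝ, 0 < c → ∀ y, ∃! z, z ∈ SetOp.resolvent (SetOp.scale c G) y) ∧
    (∀ y, ∃! z, z ∈ SetOp.resolvent (SetOp.scale η (SetOp.add F G)) y) ∧
    (∀ k : ℕ, 1 / η ^ 2 * ‖Halpern.iterate F G η L ρ x₀ k -
        SetOp.resolventMap (SetOp.scale η (SetOp.add F G)) (Halpern.iterate F G η L ρ x₀ k)‖ ^ 2 ≤
      16 * ‖x₀ - p‖ ^ 2 / ((η - ρ) ^ 2 * ((k : ℝ) + 1) ^ 2)) ∧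
    (∀ k : ℕ, Halpern.callsAt F G η L ρ x₀ k = 2 * Halpern.innerIterations η L k) := by
  have hJG : ∀ c : ℝ, 0 < c → ∀ y, ∃! z, z ∈ SetOp.resolvent (SetOp.scale c G) y :=
    fun _ hc => hG.isMaximallyCohypomonotone.existsUnique_mem_resolvent hc
  have hJ := hFG.existsUnique_mem_resolvent hρη
  have hrate := Halpern.mul_norm_relaxedResidual_iterate_le hη hηL hρη hF hG.1
    (fun c hc y => (hJG c hc y).exists) hFG.1 (fun y => (hJ y).exists) hp x₀
  exact ⟨hJG, hJ, fun k => Halpern.norm_sub_resolventMap_sq_le_of_mul_norm_relaxedResidual_le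
    hη hρη (by positivity) (hrate k), Halpern.callsAt_eq F G η L ρ x₀⟩

theorem theorem1 (d : ℕ) (F : Vec d → Vec d) (G : Vec d → Set (Vec d)) (L : ℝ≥0) (η ρ : ℝ)
    (hL : 0 < L) (hF : LipschitzWith L F) (hG : SetOp.IsMaximallyMonotone G)
    (hρ : 0 ≤ ρ) (hFG : SetOp.IsMaximallyCohypomonotone ρ (SetOp.add F G))
    (hρη : ρ < η) (hηL : η < 1 / (L : ℝ))
    (xstar : Vec d) (hstar : (0 : Vec d) ∈ SetOp.add F G xstar) (x₀ : Vec d) :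
    -- the resolvents used by the algorithm and in the bound are single-valued with full domain
    (∀ c : ℝ, 0 < c → ∀ y : Vec d, ∃! z, z ∈ SetOp.resolvent (SetOp.scale c G) y) ∧
    (∀ y : Vec d, ∃! z, z ∈ SetOp.resolvent (SetOp.scale η (SetOp.add F G)) y) ∧
    -- the last-iterate rate
    (∀ k : ℕ, 1 ≤ k →
      1 / η ^ 2 * ‖Halpern.iterate F G η L ρ x₀ k -
          SetOp.resolventMap (SetOp.scale η (SetOp.add F G)) (Halpern.iterate F G η L ρ x₀ k)‖ ^ 2
        ≤ 16 * ‖x₀ - xstar‖ ^ 2 / ((η - ρ) ^ 2 * ((k : ℝ) + 1) ^ 2)) ∧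
    -- the oracle complexity of each iteration
    (∀ k : ℕ, Halpern.callsAt F G η L ρ x₀ k ≤ 2 * Halpern.innerIterations η L k) := by
  obtain ⟨hJG, hJ, hrate, hcalls⟩ := theorem1_general hF hG hFG (hρ.trans_lt hρη) hρη
    ((lt_div_iff₀ (NNReal.coe_pos.2 hL)).1 hηL) hstar x₀
  exact ⟨hJG, hJ, fun k _ => hrate k, fun k => (hcalls k).le⟩
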